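/- Let $d\ge 2$ and $n\ge 2$ be integers. **Labeled spherical triangulations.** For $m\ge 2$, a spherical simplex in the unit sphere of $\mathbb R^m$ is the central projection to that sphere of the simplex spanned by a nonempty finite set $G$ with $0\notin G$ and $G\cup\{0\}$ affinely independent. A spherical triangulation of the unit sphere of $\mathbb R^m$ is a simplicial complex of spherical simplices in which every simplex is a face of an $(m-1)$-simplex of the complex and whose underlying space is the unit sphere (as a topological space). It is labeled if all of its vertices and the center of the sphere carry labels from $\mathbb N\cup\{0\}$. Two labeled spherical triangulations $P,Q$ are combinatorially equivalent with identical labels if there is an isomorphism of their vertex schemes under which corresponding vertices carry equal labels, and their centers carry equal labels; edges of $P$ and $Q$ then correspond via this isomorphism, and lengths of edges are measured in the geodesic metric of the unit sphere. A set $\mathbf S$ of labeled spherical triangulations of unit spheres (of any dimensions) is heteroperturbative if, for all $P,Q\in\mathbf S$ and every such isomorphism, either all corresponding edges of $P$ and $Q$ are equally long, or some edge of $P$ is strictly longer than the corresponding edge of $Q$ and some edge of $P$ is strictly shorter than the corresponding edge of $Q$. **Compact packings.** A sphere packing $\mathcal P$ of $\mathbb R^d$ is a family of spheres with pairwise disjoint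 interiors; $\mathrm{radii}(\mathcal P)$ is the set of their radii. Its contact hypergraph has the centers as vertices, and its hyperedges are the nonempty sets $E$ of at most $d+1$ centers such that the spheres centered at any two distinct points of $E$ are tangent and every center lying in the convex hull of $E$ belongs to $E$. The packing is compact if its contact hypergraph is the vertex scheme of a simplicial complex in $\mathbb R^d$ (the packing complex) in which every simplex is a face of a $d$-simplex of the complex and whose underlying space is $\mathbb R^d$ (as a topological space). If $\mathrm{radii}(\mathcal P)=\{r_0<\dots<r_{n-1}\}$, the center of a sphere of radius $r_j$ is labeled $j$. The canonical labeled triangulation of a sphere $A\in\mathcal P$ is the labeled spherical triangulation of the unit sphere obtained by projecting the link of the center of $A$ in the packing complex centrally onto $A$, carrying the labels of the vertices and of the center along, and translating and scaling $A$ to the unit sphere. The packing is associated to $\mathbf S$ if the canonical labeled triangulation of each of its spheres is an element of $\mathbf S$. **Theorem.** For every heteroperturbative set $\mathbf S$ of labeled spherical triangulations of unit spheres, the set $$\Pi_{d,n}(\mathbf S)=\{\mathrm{radii}(\mathcal P):\ \mathcal P\text{ a compact sphere packing of }\mathbb R^d\text{ associated to }\mathbf S,\ |\mathrm{radii}(\mathcal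 P)|=n,\ \max\mathrm{radii}(\mathcal P)=1\}$$ is finite. -/

import Mathlib

open Set

noncomputable section

/-- Central projection of `ℝᵈ \ {0}` onto the unit sphere. -/
def centralProjection {d : ℕ} (x : EuclideanSpace ℝ (Fin d)) : EuclideanSpace ℝ (Fin d) :=
  ‖x‖⁻¹ • x

/-- The spherical simplex spanned by `G`: the central projection of the simplex spanned by `G`. -/
def sphericalSimplex {d : ℕ} (G : Set (EuclideanSpace ℝ (Fin d))) :
    Set (EuclideanSpace ℝ (Fin d)) :=
  centralProjection '' convexHull ℝ G

/-- A labeled spherical triangulation of the unit sphere of `ℝᵈ`, where `2 ≤ d`.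
A spherical simplex determines its vertices, which are unit vectors, so a spherical simplicial
complex is stored as the collection `faces` of the (nonempty, finite) vertex sets of its simplices.
The vertices and the center of the sphere carry labels in `ℕ`. -/
@[ext]
structure LabeledSphericalTriangulation (d : ℕ) extends
    PreAbstractSimplicialComplex (EuclideanSpace ℝ (Fin d)) where
  two_le : 2 ≤ d
  norm_eq_one : ∀ s ∈ faces, ∀ v ∈ s, ‖v‖ = 1
  /-- Every face together with `0` is affinely independent (and does not contain `0`). -/
  indep : ∀ s ∈ faces, LinearIndependent ℝ ((↑) : s → EuclideanSpace ℝ (Fin d))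
  /-- Two spherical simplices meet in the simplex spanned by their common vertices
  (in the empty set if there are none). -/
  inter_subset : ∀ s ∈ faces, ∀ t ∈ faces,
    sphericalSimplex (s : Set (EuclideanSpace ℝ (Fin d))) ∩ sphericalSimplex ↑t ⊆
      sphericalSimplex (↑s ∩ ↑t)
  /-- Homogeneity: every simplex is a face of a `(d-1)`-simplex of the complex. -/
  homogeneous : ∀ s ∈ faces, ∃ t ∈ faces, s ⊆ t ∧ t.card = d
  /-- The underlying space is the unit sphere as a set ... -/
  iUnion_eq : ⋃ s ∈ faces, sphericalSimplex (s : Set (EuclideanSpace ℝ (Fin d))) =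
    Metric.sphere 0 1
  /-- ... and as a topological space (the underlying space of a complex carries the topology
  coherent with its simplices). -/
  coherent : Topology.IsCoherentWith
    {A : Set (Metric.sphere (0 : EuclideanSpace ℝ (Fin d)) 1) |
      ∃ s ∈ faces, A = (↑) ⁻¹' sphericalSimplex (s : Set (EuclideanSpace ℝ (Fin d)))}
  /-- The label of the center of the sphere. -/
  centerLabel : ℕ
  /-- The labels of the vertices. -/
  label : {v : EuclideanSpace ℝ (Fin d) // {v} ∈ faces} → ℕ

namespace LabeledSphericalTriangulation

variable {d d' : ℕ}

/-- The vertices of a labeled spherical triangulation. -/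
abbrev Vertex (P : LabeledSphericalTriangulation d) : Type :=
  {v : EuclideanSpace ℝ (Fin d) // {v} ∈ P.faces}

/-- `v` and `w` are the ends of an edge (a `1`-simplex) of `P`. -/
def IsEdge (P : LabeledSphericalTriangulation d) (v w : P.Vertex) : Prop :=
  v ≠ w ∧ ∃ s ∈ P.faces, (s : Set (EuclideanSpace ℝ (Fin d))) = {v.1, w.1}

/-- The distance of two vertices in the geodesic metric of the unit sphere. -/
def geodesicDist (P : LabeledSphericalTriangulation d) (v w : P.Vertex) : ℝ :=
  InnerProductGeometry.angle v.1 w.1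

/-- `e` is a combinatorial equivalence (an isomorphism of vertex schemes) with identical labels on
corresponding vertices and on the centers. -/
structure IsLabeledEquiv (P : LabeledSphericalTriangulation d)
    (Q : LabeledSphericalTriangulation d') (e : P.Vertex ≃ Q.Vertex) : Prop where
  mem_faces_iff : ∀ s : Finset P.Vertex,
    s.map (Function.Embedding.subtype _) ∈ P.faces ↔
      (s.map e.toEmbedding).map (Function.Embedding.subtype _) ∈ Q.faces
  centerLabel_eq : Q.centerLabel = P.centerLabel
  label_eq : ∀ v, Q.label (e v) = P.label v

/-- Corresponding edges of `P` and `Q` are equally long. -/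
def EdgeIsometric (P : LabeledSphericalTriangulation d)
    (Q : LabeledSphericalTriangulation d') (e : P.Vertex ≃ Q.Vertex) : Prop :=
  ∀ v w, P.IsEdge v w → P.geodesicDist v w = Q.geodesicDist (e v) (e w)

end LabeledSphericalTriangulation

/-- A set of labeled spherical triangulations of unit spheres (of arbitrary dimensions) is
heteroperturbative if, whenever two of its elements correspond with identical labels and are not
edge-isometric, some edge of the first is strictly longer, and some edge of the first is strictly
shorter, than the corresponding edge of the second. -/
def IsHeteroperturbative (S : Set (Σ d : ℕ, LabeledSphericalTriangulation d)) : Prop :=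
  ∀ P ∈ S, ∀ Q ∈ S, ∀ e : P.2.Vertex ≃ Q.2.Vertex, P.2.IsLabeledEquiv Q.2 e →
    ¬ P.2.EdgeIsometric Q.2 e →
      (∃ u v, P.2.IsEdge u v ∧ Q.2.geodesicDist (e u) (e v) < P.2.geodesicDist u v) ∧
      (∃ x y, P.2.IsEdge x y ∧ P.2.geodesicDist x y < Q.2.geodesicDist (e x) (e y))

/-- A sphere packing of `ℝᵈ`, given by the centers of its spheres and the radius of the sphere at
each center (only the values of `radius` on `centers` matter). -/
structure SpherePacking (d : ℕ) where
  centers : Set (EuclideanSpace ℝ (Fin d))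
  radius : EuclideanSpace ℝ (Fin d) → ℝ
  radius_pos : ∀ a ∈ centers, 0 < radius a
  /-- The spheres have pairwise disjoint interiors. -/
  disjoint : ∀ a ∈ centers, ∀ b ∈ centers, a ≠ b →
    Disjoint (Metric.ball a (radius a)) (Metric.ball b (radius b))

namespace SpherePacking

variable {d : ℕ}

/-- The set of radii of the spheres of the packing. -/
def radii (p : SpherePacking d) : Set ℝ := p.radius '' p.centers

/-- The (nonempty) hyperedges of the contact hypergraph. -/
def contactHyperedges (p : SpherePacking d) : Set (Finset (EuclideanSpace ℝ (Fin d))) :=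
  {s | s.Nonempty ∧ (s : Set (EuclideanSpace ℝ (Fin d))) ⊆ p.centers ∧ s.card ≤ d + 1 ∧
    (∀ a ∈ s, ∀ b ∈ s, a ≠ b → dist a b = p.radius a + p.radius b) ∧
    (∀ c ∈ p.centers, c ∈ convexHull ℝ (s : Set (EuclideanSpace ℝ (Fin d))) → c ∈ s)}

/-- The packing is compact: the contact hypergraph is the vertex scheme of a homogeneous simplicial
`d`-complex in `ℝᵈ` (the packing complex) whose underlying space, with the topology coherent with
the simplices, is `ℝᵈ`. -/
def IsCompactPacking (p : SpherePacking d) : Prop :=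
  ∃ K : Geometry.SimplicialComplex ℝ (EuclideanSpace ℝ (Fin d)),
    K.faces = p.contactHyperedges ∧
    (∀ s ∈ K.faces, ∃ t ∈ K.faces, s ⊆ t ∧ t.card = d + 1) ∧
    K.space = univ ∧
    Topology.IsCoherentWith
      {A | ∃ s ∈ K.faces, A = convexHull ℝ (s : Set (EuclideanSpace ℝ (Fin d)))}

/-- The canonical label of the sphere with center `a`: if the radii are
`r₀ < r₁ < ⋯ < rₙ₋₁`, a sphere of radius `rⱼ` has label `j`. -/
def canonicalLabel (p : SpherePacking d) (a : EuclideanSpace ℝ (Fin d)) : ℕ :=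
  {r ∈ p.radii | r < p.radius a}.ncard

/-- The link of `a` in the packing complex: the simplices `s` with `a ∉ s` for which `{a} ∪ s` is
a simplex. -/
def link (p : SpherePacking d) (a : EuclideanSpace ℝ (Fin d)) :
    Set (Finset (EuclideanSpace ℝ (Fin d))) :=
  {s | s.Nonempty ∧ a ∉ s ∧
    ∃ t ∈ p.contactHyperedges, (t : Set (EuclideanSpace ℝ (Fin d))) = insert a ↑s}

/-- `P` is the canonical labeled triangulation associated to the sphere of `p` with center `a`:
the central projection of the link of `a`, translated and scaled to the unit sphere, with the
labels carried along. -/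
structure IsCanonicalTriangulation (p : SpherePacking d) (a : EuclideanSpace ℝ (Fin d))
    (P : LabeledSphericalTriangulation d) : Prop where
  mem_faces_iff : ∀ s, s ∈ P.faces ↔ ∃ t ∈ p.link a,
    (s : Set (EuclideanSpace ℝ (Fin d))) = (fun v => centralProjection (v - a)) '' ↑t
  centerLabel_eq : P.centerLabel = p.canonicalLabel a
  label_eq : ∀ t ∈ p.link a, ∀ v ∈ t, ∀ u : P.Vertex,
    u.1 = centralProjection (v - a) → P.label u = p.canonicalLabel v

/-- A sphere has at most one canonical labeled triangulation. -/
theorem IsCanonicalTriangulation.unique {p : SpherePacking d} {a : EuclideanSpace ℝ (Fin d)}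
    {P Q : LabeledSphericalTriangulation d} (hP : p.IsCanonicalTriangulation a P)
    (hQ : p.IsCanonicalTriangulation a Q) : P = Q := by
  have hf : P.faces = Q.faces := by
    ext s
    rw [hP.mem_faces_iff, hQ.mem_faces_iff]
  have hl : ∀ (v : EuclideanSpace ℝ (Fin d)) (h : {v} ∈ P.faces) (h' : {v} ∈ Q.faces),
      P.label ⟨v, h⟩ = Q.label ⟨v, h'⟩ := by
    intro v h h'
    obtain ⟨t, ht, he⟩ := (hP.mem_faces_iff _).1 h
    obtain ⟨w, hw, hwv⟩ : v ∈ (fun v => centralProjection (v - a)) '' (t : Set _) := by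
      rw [← he]; simp
    rw [hP.label_eq t ht w hw ⟨v, h⟩ hwv.symm, hQ.label_eq t ht w hw ⟨v, h'⟩ hwv.symm]
  have hc : P.centerLabel = Q.centerLabel := hP.centerLabel_eq.trans hQ.centerLabel_eq.symm
  obtain ⟨⟨F, _⟩, _, _, _, _, _, _, _, c, l⟩ := P
  obtain ⟨⟨F', _⟩, _, _, _, _, _, _, _, c', l'⟩ := Q
  obtain rfl : F = F' := hf
  obtain rfl : c = c' := hc
  obtain rfl : l = l' := by
    funext v
    exact hl v.1 v.2 v.2
  rfl

/-- The packing is associated to `S`: the canonical labeled triangulation of each of its spheres is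
an element of `S`. -/
def IsAssociatedTo (p : SpherePacking d)
    (S : Set (Σ d : ℕ, LabeledSphericalTriangulation d)) : Prop :=
  ∀ a ∈ p.centers, ∃ P : LabeledSphericalTriangulation d,
    p.IsCanonicalTriangulation a P ∧ (⟨d, P⟩ : Σ d : ℕ, LabeledSphericalTriangulation d) ∈ S

end SpherePacking

/-- The set `Π_{d,n}(S)` of the sets of radii of compact sphere packings of `ℝᵈ` that are associated
to `S` and have exactly `n` radii, the largest of them being `1`. -/
def radiiConfigurations (d n : ℕ) (S : Set (Σ d : ℕ, LabeledSphericalTriangulation d)) :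
    Set (Set ℝ) :=
  {R | ∃ p : SpherePacking d, p.IsCompactPacking ∧ p.IsAssociatedTo S ∧
    p.radii.encard = n ∧ IsGreatest p.radii 1 ∧ R = p.radii}

end

/-!
The angle at the center of a sphere of radius `r` between two spheres of radii `s` and `t`, all three
touching, increases with `s / r` and with `t / r` (`contactAngle_lt_contactAngle`). Compare two
packings with vectors of radii `r` and `r'`, and let `M` be the set of labels `i` for which
`r' i / r i` is minimal. Around a sphere labeled in `M`, no angle decreases on passing from `r` to
`r'`, and some angle increases if a neighbor is labeled outside `M`. So heteroperturbativity forbids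
such a sphere to have the same labeled combinatorial type in both packings
(`IsHeteroperturbative.not_hasCorona`). If `M` is not the set of all labels, each packing has a sphere
labeled in `M` with a neighbor labeled outside `M`, because `ℝᵈ` is connected
(`SpherePacking.IsCompactPacking.exists_mem_link`); if `M` consists of all labels then `r = r'`, as
both maxima are `1`.

Were there infinitely many vectors of radii, infinitely many of them would realize the same types if
only finitely many types could occur. The number of neighbors of a sphere is not bounded, but it is
bounded in terms of the ratio of its radius to the least radius
(`SpherePacking.le_dist_centralProjection`). After passing to an infinite subset, each radius relative
to the least one is bounded, for the labels in a set `L`, or tends to infinity, for the others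
(`exists_infinite_bounded_or_escaping`). Fix `r`; for all but finitely many `r'` in the subset, the
labels outside `L` have grown relative to the least radius, so that `M ⊆ L`, and for labels in `L`
only finitely many types occur.
-/

open Set

/-! ### Angles between mutually tangent spheres -/

/-- The angle, at the center of a sphere of radius `r`, between the centers of spheres of radii `s`
and `t`, when the three spheres touch each other from outside. -/
noncomputable def contactAngle (r s t : ℝ) : ℝ :=
  Real.arccos (1 - 2 * (s / (r + s)) * (t / (r + t)))

/-- The law of cosines in the triangle of the centers. -/
lemma angle_eq_contactAngle {E : Type*} [NormedAddCommGroup E] [InnerProductSpace ℝ E]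
    {a v w : E} {r s t : ℝ} (hr : 0 < r) (hs : 0 < s) (ht : 0 < t)
    (hv : dist a v = r + s) (hw : dist a w = r + t) (hvw : dist v w = s + t) :
    InnerProductGeometry.angle (v - a) (w - a) = contactAngle r s t := by
  have h1 : ‖v - a‖ = r + s := by rw [← dist_eq_norm, dist_comm, hv]
  have h2 : ‖w - a‖ = r + t := by rw [← dist_eq_norm, dist_comm, hw]
  have h3 : ‖(v - a) - (w - a)‖ = s + t := by rw [sub_sub_sub_cancel_right, ← dist_eq_norm, hvw]
  unfold InnerProductGeometry.angle contactAngle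
  rw [real_inner_eq_norm_mul_self_add_norm_mul_self_sub_norm_sub_mul_self_div_two, h1, h2, h3]
  congr 1
  field_simp
  ring

lemma div_add_le_div_add {r s r' s' : ℝ} (hr : 0 < r) (hs : 0 < s) (hr' : 0 < r') (hs' : 0 < s')
    (h : s / r ≤ s' / r') : s / (r + s) ≤ s' / (r' + s') := by
  rw [div_le_div_iff₀ hr hr'] at h
  rw [div_le_div_iff₀ (by positivity) (by positivity)]
  linarith

lemma div_add_lt_div_add {r s r' s' : ℝ} (hr : 0 < r) (hs : 0 < s) (hr' : 0 < r') (hs' : 0 < s')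
    (h : s / r < s' / r') : s / (r + s) < s' / (r' + s') := by
  rw [div_lt_div_iff₀ hr hr'] at h
  rw [div_lt_div_iff₀ (by positivity) (by positivity)]
  linarith

/-- The contact angle is increasing in the radii of the two outer spheres relative to that of the
central one. -/
lemma contactAngle_le_contactAngle {r s t r' s' t' : ℝ} (hr : 0 < r) (hs : 0 < s) (ht : 0 < t)
    (hr' : 0 < r') (hs' : 0 < s') (ht' : 0 < t') (h : s / r ≤ s' / r') (k : t / r ≤ t' / r') :
    contactAngle r s t ≤ contactAngle r' s' t' := by
  refine Real.arccos_le_arccos ?_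
  have h1 := div_add_le_div_add hr hs hr' hs' h
  have h2 := div_add_le_div_add hr ht hr' ht' k
  have := mul_le_mul h1 h2 (by positivity) (by positivity)
  linarith

lemma contactAngle_lt_contactAngle {r s t r' s' t' : ℝ} (hr : 0 < r) (hs : 0 < s) (ht : 0 < t)
    (hr' : 0 < r') (hs' : 0 < s') (ht' : 0 < t') (h : s / r < s' / r') (k : t / r ≤ t' / r') :
    contactAngle r s t < contactAngle r' s' t' := by
  have h1 := div_add_lt_div_add hr hs hr' hs' h
  have h2 := div_add_le_div_add hr ht hr' ht' k
  have h3 := mul_lt_mul h1 h2 (by positivity) (by positivity)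
  have h4 : s' / (r' + s') ≤ 1 := by
    rw [div_le_one (by positivity)]
    linarith
  have h5 : t' / (r' + t') ≤ 1 := by
    rw [div_le_one (by positivity)]
    linarith
  have h6 := mul_le_mul h4 h5 (by positivity) zero_le_one
  have h7 : 0 ≤ s / (r + s) * (t / (r + t)) := by positivity
  exact Real.arccos_lt_arccos (by linarith) (by linarith) (by linarith)

/-! ### Spherical triangulations with few vertices -/

/-- Sets of unit vectors with pairwise distances at least `δ` have boundedly many elements. -/
lemma exists_card_bound_of_separated (d : ℕ) {δ : ℝ} (hδ : 0 < δ) :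
    ∃ N : ℕ, ∀ A : Set (EuclideanSpace ℝ (Fin d)), (∀ x ∈ A, ‖x‖ = 1) →
      (∀ x ∈ A, ∀ y ∈ A, x ≠ y → δ ≤ dist x y) → A.Finite ∧ A.ncard ≤ N := by
  obtain ⟨t, ht, hcov⟩ := Metric.totallyBounded_iff.1
    (isCompact_sphere (0 : EuclideanSpace ℝ (Fin d)) 1).totallyBounded (δ / 2) (half_pos hδ)
  refine ⟨t.ncard, fun A hA hsep => ?_⟩
  have hx : ∀ x ∈ A, ∃ y ∈ t, dist x y < δ / 2 := fun x hx => by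
    simpa using hcov (mem_sphere_zero_iff_norm.2 (hA x hx))
  choose! f hf hfx using hx
  have hinj : InjOn f A := fun x hxA y hyA hxy => by
    by_contra hne
    have h1 := hfx x hxA
    have h2 := hfx y hyA
    rw [← hxy] at h2
    linarith [hsep x hxA y hyA hne, dist_triangle_right x y (f x)]
  exact ⟨ht.of_injOn hf hinj, ncard_le_ncard_of_injOn f hf hinj ht⟩

/-- The labeled combinatorial schemes with at most `N` vertices and vertex labels below `n`: the
number of vertices, the faces, the labels of the vertices and the label of the center. -/
abbrev LabeledScheme (N n : ℕ) : Type :=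
  Σ m : Fin (N + 1), Set (Finset (Fin m)) × (Fin m → Fin n) × Fin n

namespace LabeledSphericalTriangulation

variable {d d' : ℕ}

lemma singleton_mem_faces (P : LabeledSphericalTriangulation d)
    {s : Finset (EuclideanSpace ℝ (Fin d))} (hs : s ∈ P.faces) {v : EuclideanSpace ℝ (Fin d)}
    (hv : v ∈ s) : {v} ∈ P.faces :=
  (P.isRelLowerSet_faces hs).2 (by simpa using hv) (by simp)

lemma exists_isEdge (P : LabeledSphericalTriangulation d) (u : P.Vertex) : ∃ v, P.IsEdge u v := by
  classical
  obtain ⟨t, ht, hut, hcard⟩ := P.homogeneous _ u.2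
  have hu : u.1 ∈ t := by simpa using hut
  obtain ⟨w, hw, hwu⟩ := Finset.exists_mem_ne (by have := P.two_le; omega : 1 < t.card) u.1
  refine ⟨⟨w, P.singleton_mem_faces ht hw⟩, fun h => hwu (congrArg Subtype.val h).symm,
    {u.1, w}, (P.isRelLowerSet_faces ht).2 ?_ (by simp), by simp⟩
  simp [Finset.insert_subset_iff, hu, hw]

/-- A combinatorial equivalence carries edges to edges. -/
lemma IsLabeledEquiv.isEdge {P : LabeledSphericalTriangulation d}
    {Q : LabeledSphericalTriangulation d'} {e : P.Vertex ≃ Q.Vertex} (he : P.IsLabeledEquiv Q e)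
    {u v : P.Vertex} (h : P.IsEdge u v) : Q.IsEdge (e u) (e v) := by
  classical
  obtain ⟨hne, s, hs, hsuv⟩ := h
  refine ⟨fun h => hne (e.injective h), _, (he.mem_faces_iff {u, v}).1 ?_, by simp⟩
  convert! hs
  ext x
  rw [← Finset.mem_coe, ← Finset.mem_coe, hsuv]
  simp

/-- `P` has the labeled scheme `τ`, up to a numbering of its vertices. -/
def HasScheme {N n : ℕ} (P : LabeledSphericalTriangulation d) (τ : LabeledScheme N n) : Prop :=
  P.centerLabel = τ.2.2.2 ∧ ∃ e : Fin τ.1 ≃ P.Vertex,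
    (∀ s, s ∈ τ.2.1 ↔ (s.map e.toEmbedding).map (Function.Embedding.subtype _) ∈ P.faces) ∧
      ∀ i, P.label (e i) = τ.2.2.1 i

lemma exists_hasScheme {N n : ℕ} (P : LabeledSphericalTriangulation d)
    (hfin : {v | {v} ∈ P.faces}.Finite) (hN : {v | {v} ∈ P.faces}.ncard ≤ N)
    (hc : P.centerLabel < n) (hl : ∀ v, P.label v < n) :
    ∃ τ : LabeledScheme N n, P.HasScheme τ := by
  have : Finite P.Vertex := hfin
  have hcard : Nat.card P.Vertex ≤ N := hN
  let e : Fin (Nat.card P.Vertex) ≃ P.Vertex := (Finite.equivFin P.Vertex).symm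
  exact ⟨⟨⟨Nat.card P.Vertex, by omega⟩,
    {s | (s.map e.toEmbedding).map (Function.Embedding.subtype _) ∈ P.faces},
    fun i => ⟨P.label (e i), hl _⟩, ⟨P.centerLabel, hc⟩⟩, rfl, e, fun _ => Iff.rfl, fun _ => rfl⟩

lemma HasScheme.exists_isLabeledEquiv {N n : ℕ} {P : LabeledSphericalTriangulation d}
    {Q : LabeledSphericalTriangulation d'} {τ : LabeledScheme N n} (hP : P.HasScheme τ)
    (hQ : Q.HasScheme τ) : ∃ e : P.Vertex ≃ Q.Vertex, P.IsLabeledEquiv Q e := by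
  obtain ⟨hcP, e, hfP, hlP⟩ := hP
  obtain ⟨hcQ, f, hfQ, hlQ⟩ := hQ
  refine ⟨e.symm.trans f, fun s => ?_, hcQ.trans hcP.symm, fun v => ?_⟩
  · have h := (hfP (s.map e.symm.toEmbedding)).symm.trans (hfQ (s.map e.symm.toEmbedding))
    convert h using 2
    · simp [Finset.map_map]
    · simp [Finset.map_map]
  · rw [Equiv.trans_apply, hlQ, ← hlP, Equiv.apply_symm_apply]

end LabeledSphericalTriangulation

/-! ### Compact packings -/

namespace SpherePacking

variable {d n : ℕ} {p : SpherePacking d} {a : EuclideanSpace ℝ (Fin d)} {r : Fin n → ℝ}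

lemma canonicalLabel_eq (hr : StrictMono r) (hp : range r = p.radii) {i : Fin n}
    (ha : p.radius a = r i) : p.canonicalLabel a = i := by
  have h : {x ∈ p.radii | x < p.radius a} = r '' Iio i := by
    ext x
    rw [← hp, ha]
    constructor
    · rintro ⟨⟨j, rfl⟩, hj⟩
      exact ⟨j, hr.lt_iff_lt.1 hj, rfl⟩
    · rintro ⟨j, hj, rfl⟩
      exact ⟨⟨j, rfl⟩, hr hj⟩
  rw [canonicalLabel, h, ncard_image_of_injective _ hr.injective]
  simp [ncard_eq_toFinset_card']

lemma exists_radius_eq (hr : StrictMono r) (hp : range r = p.radii) (ha : a ∈ p.centers) :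
    ∃ i, p.radius a = r i ∧ p.canonicalLabel a = i := by
  obtain ⟨i, hi⟩ : p.radius a ∈ range r := hp ▸ mem_image_of_mem _ ha
  exact ⟨i, hi.symm, canonicalLabel_eq hr hp hi.symm⟩

lemma pos_of_range_eq (hp : range r = p.radii) (i : Fin n) : 0 < r i := by
  obtain ⟨a, ha, hai⟩ : r i ∈ p.radii := hp ▸ mem_range_self i
  exact hai ▸ p.radius_pos a ha

lemma dist_of_mem_link {s : Finset (EuclideanSpace ℝ (Fin d))} (hs : s ∈ p.link a)
    {v : EuclideanSpace ℝ (Fin d)} (hv : v ∈ s) :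
    v ∈ p.centers ∧ dist a v = p.radius a + p.radius v ∧
      ∀ w ∈ s, v ≠ w → dist v w = p.radius v + p.radius w := by
  obtain ⟨-, has, t, ⟨-, htc, -, ht, -⟩, hts⟩ := hs
  have hat : a ∈ t := by
    rw [← Finset.mem_coe, hts]
    exact mem_insert _ _
  have hst : ∀ x ∈ s, x ∈ t := fun x hx => by
    rw [← Finset.mem_coe, hts]
    exact mem_insert_of_mem _ hx
  exact ⟨htc (hst v hv), ht a hat v (hst v hv) (by rintro rfl; exact has hv),
    fun w hw hne => ht v (hst v hv) w (hst w hw) hne⟩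

/-- Two spheres touching the sphere with center `a` are seen from `a` in directions that are not too
close to each other: by tangency each of the two contains a ball of radius `m` that touches the
sphere with center `a`, and these balls are disjoint. -/
lemma le_dist_centralProjection {m B : ℝ} (hm : 0 < m) (hmr : ∀ c ∈ p.centers, m ≤ p.radius c)
    (ha : a ∈ p.centers) (hB : p.radius a ≤ B * m) {v w : EuclideanSpace ℝ (Fin d)}
    (hv : v ∈ p.centers) (hw : w ∈ p.centers) (hav : dist a v = p.radius a + p.radius v)
    (haw : dist a w = p.radius a + p.radius w) (hne : v ≠ w) :
    2 / (B + 1) ≤ dist (centralProjection (v - a)) (centralProjection (w - a)) := by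
  have ha0 := p.radius_pos a ha
  have hv0 := p.radius_pos v hv
  have hw0 := p.radius_pos w hw
  have hB0 : 0 < B := pos_of_mul_pos_left (ha0.trans_le hB) hm.le
  have key : ∀ x, 0 < p.radius x → dist a x = p.radius a + p.radius x →
      x - a = (p.radius a + m) • centralProjection (x - a) +
        (p.radius x - m) • centralProjection (x - a) ∧ ‖centralProjection (x - a)‖ = 1 := by
    intro x hx h
    have hn : ‖x - a‖ = p.radius a + p.radius x := by rw [← dist_eq_norm, dist_comm, h]
    have hn0 : 0 < ‖x - a‖ := by rw [hn]; positivity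
    constructor
    · rw [← add_smul, add_add_sub_cancel, ← hn, centralProjection, smul_inv_smul₀ hn0.ne']
    · rw [centralProjection, norm_smul, norm_inv, norm_norm, inv_mul_cancel₀ hn0.ne']
  obtain ⟨h1, hn1⟩ := key v hv0 hav
  obtain ⟨h2, hn2⟩ := key w hw0 haw
  have hdisj := (disjoint_ball_ball_iff hv0 hw0).1 (p.disjoint v hv w hw hne)
  set x := centralProjection (v - a)
  set y := centralProjection (w - a)
  have hvw : dist v w = ‖(p.radius a + m) • (x - y) +
      ((p.radius v - m) • x - (p.radius w - m) • y)‖ := by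
    rw [dist_eq_norm, ← sub_sub_sub_cancel_right v w a, h1, h2]
    congr 1
    module
  have hle : dist v w ≤ (p.radius a + m) * dist x y + ((p.radius v - m) + (p.radius w - m)) := by
    rw [hvw, dist_eq_norm]
    refine (norm_add_le _ _).trans (add_le_add ?_ ((norm_sub_le _ _).trans ?_))
    · rw [norm_smul, Real.norm_of_nonneg (by positivity)]
    · rw [norm_smul, norm_smul, hn1, hn2, Real.norm_of_nonneg (sub_nonneg.2 (hmr v hv)),
        Real.norm_of_nonneg (sub_nonneg.2 (hmr w hw)), mul_one, mul_one]
  have h3 : 2 * m ≤ (p.radius a + m) * dist x y := by linarith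
  have h4 : (p.radius a + m) * dist x y ≤ ((B + 1) * m) * dist x y :=
    mul_le_mul_of_nonneg_right (by linarith) dist_nonneg
  rw [div_le_iff₀ (by positivity)]
  nlinarith

/-- The spheres of a compact packing cannot be split into two nonempty families without contacts
between them: the parts of the packing complex spanned by the two families would be disjoint, and
both open because the topology is coherent with the simplices. -/
lemma IsCompactPacking.exists_mem_link (hp : p.IsCompactPacking)
    (C : Set (EuclideanSpace ℝ (Fin d))) (h₁ : ∃ a ∈ p.centers, a ∈ C)
    (h₂ : ∃ b ∈ p.centers, b ∉ C) :
    ∃ a ∈ p.centers, a ∈ C ∧ ∃ b ∉ C, {b} ∈ p.link a := by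
  classical
  obtain ⟨K, hK, -, hspace, hcoh⟩ := hp
  have hpure : (∃ t ∈ K.faces, ∃ a ∈ t, ∃ b ∈ t, a ∈ C ∧ b ∉ C) := by
    by_contra! hcon
    let A := {x | ∃ s ∈ K.faces, (∀ c ∈ s, c ∈ C) ∧
      x ∈ convexHull ℝ (s : Set (EuclideanSpace ℝ (Fin d)))}
    have hvert : ∀ c ∈ p.centers, {c} ∈ K.faces := fun c hc => by
      rw [hK]
      exact ⟨by simp, by simpa using hc, by simp, by simp, by simp⟩
    have hout : ∀ t ∈ K.faces, (∃ c ∈ t, c ∉ C) →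
        ∀ x ∈ convexHull ℝ (t : Set (EuclideanSpace ℝ (Fin d))), x ∉ A := by
      rintro t ht ⟨c, hct, hc⟩ x hx ⟨s, hs, hsC, hxs⟩
      have h := K.inter_subset_convexHull hs ht ⟨hxs, hx⟩
      obtain ⟨y, hys, hyt⟩ := convexHull_nonempty_iff.1 ⟨x, h⟩
      exact hc (hcon t ht y hyt c hct (hsC y hys))
    have hclopen : IsClopen A := by
      have hface : ∀ s ∈ {A | ∃ s ∈ K.faces,
          A = convexHull ℝ (s : Set (EuclideanSpace ℝ (Fin d)))},
          ((↑) ⁻¹' A : Set s) = univ ∨ ((↑) ⁻¹' A : Set s) = ∅ := by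
        rintro _ ⟨s, hs, rfl⟩
        by_cases h : ∀ c ∈ s, c ∈ C
        · exact Or.inl (eq_univ_of_forall fun x => ⟨s, hs, h, x.2⟩)
        · push Not at h
          exact Or.inr (eq_empty_of_forall_notMem fun x hx => hout s hs h x x.2 hx)
      constructor
      · rw [hcoh.isClosed_iff]
        intro s hs
        rcases hface s hs with h | h <;> simp [h]
      · rw [hcoh.isOpen_iff]
        intro s hs
        rcases hface s hs with h | h <;> simp [h]
    obtain ⟨a, ha, haC⟩ := h₁
    obtain ⟨b, hb, hbC⟩ := h₂
    rcases isClopen_iff.1 hclopen with h | h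
    · exact (h ▸ notMem_empty a) ⟨{a}, hvert a ha, by simpa using haC, by simp⟩
    · exact hout {b} (hvert b hb) ⟨b, by simp, hbC⟩ b (by simp) (h ▸ mem_univ b)
  obtain ⟨t, ht, a, hat, b, hbt, haC, hbC⟩ := hpure
  have hab : {a, b} ∈ K.faces :=
    K.down_closed ht (by simp [Finset.insert_subset_iff, hat, hbt]) (by simp)
  have htc : (t : Set (EuclideanSpace ℝ (Fin d))) ⊆ p.centers := by
    rw [hK] at ht
    exact ht.2.1
  refine ⟨a, htc hat, haC, b, hbC, by simp, ?_, {a, b}, hK ▸ hab, by simp⟩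
  rw [Finset.mem_singleton]
  rintro rfl
  exact hbC haC

namespace IsCanonicalTriangulation

variable {P : LabeledSphericalTriangulation d}

lemma exists_mem_link (hP : p.IsCanonicalTriangulation a P) (u : P.Vertex) :
    ∃ t ∈ p.link a, ∃ v ∈ t, u.1 = centralProjection (v - a) := by
  obtain ⟨t, ht, hut⟩ := (hP.mem_faces_iff _).1 u.2
  have hu : u.1 ∈ (fun v => centralProjection (v - a)) '' (t : Set _) := by
    rw [← hut]
    simp
  obtain ⟨v, hv, hvu⟩ := hu
  exact ⟨t, ht, v, hv, hvu.symm⟩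

lemma label_lt (hr : StrictMono r) (hp : range r = p.radii) (hP : p.IsCanonicalTriangulation a P)
    (u : P.Vertex) : P.label u < n := by
  obtain ⟨t, ht, v, hv, hu⟩ := hP.exists_mem_link u
  obtain ⟨i, -, hi⟩ := exists_radius_eq hr hp (dist_of_mem_link ht hv).1
  rw [hP.label_eq t ht v hv u hu, hi]
  exact i.2

/-- The length of an edge of the canonical triangulation is determined by the labels of the center
and of the ends of the edge. -/
lemma geodesicDist_eq (hr : StrictMono r) (hp : range r = p.radii)
    (hP : p.IsCanonicalTriangulation a P) (ha : a ∈ p.centers) {i : Fin n} (hi : p.radius a = r i)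
    {u v : P.Vertex} (huv : P.IsEdge u v) :
    ∃ j k : Fin n, P.label u = j ∧ P.label v = k ∧
      P.geodesicDist u v = contactAngle (r i) (r j) (r k) := by
  obtain ⟨hne, s, hs, hsuv⟩ := huv
  obtain ⟨t, ht, hst⟩ := (hP.mem_faces_iff s).1 hs
  rw [hsuv] at hst
  obtain ⟨x, hx, hxu⟩ : u.1 ∈ (fun v => centralProjection (v - a)) '' (t : Set _) := by
    rw [← hst]
    simp
  obtain ⟨y, hy, hyv⟩ : v.1 ∈ (fun v => centralProjection (v - a)) '' (t : Set _) := by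
    rw [← hst]
    simp
  have hxy : x ≠ y := by
    rintro rfl
    exact hne (Subtype.ext (hxu.symm.trans hyv))
  obtain ⟨hxc, hax, hd⟩ := dist_of_mem_link ht hx
  obtain ⟨hyc, hay, -⟩ := dist_of_mem_link ht hy
  obtain ⟨j, hj, hlj⟩ := exists_radius_eq hr hp hxc
  obtain ⟨k, hk, hlk⟩ := exists_radius_eq hr hp hyc
  refine ⟨j, k, ?_, ?_, ?_⟩
  · rw [hP.label_eq t ht x hx u hxu.symm, hlj]
  · rw [hP.label_eq t ht y hy v hyv.symm, hlk]
  have hn : ∀ z ∈ p.centers, dist a z = p.radius a + p.radius z → 0 < ‖z - a‖⁻¹ := by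
    intro z hz h
    rw [← dist_eq_norm, dist_comm, h]
    have := p.radius_pos a ha
    have := p.radius_pos z hz
    positivity
  rw [LabeledSphericalTriangulation.geodesicDist, ← hxu, ← hyv, ← hi, ← hj, ← hk]
  simp only [centralProjection]
  rw [InnerProductGeometry.angle_smul_left_of_pos _ _ (hn x hxc hax),
    InnerProductGeometry.angle_smul_right_of_pos _ _ (hn y hyc hay)]
  exact angle_eq_contactAngle (p.radius_pos a ha) (p.radius_pos x hxc) (p.radius_pos y hyc) hax hay
    (hd y hy hxy)

lemma separated_vertices (hP : p.IsCanonicalTriangulation a P) {m B : ℝ} (hm : 0 < m)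
    (hmr : ∀ c ∈ p.centers, m ≤ p.radius c) (ha : a ∈ p.centers) (hB : p.radius a ≤ B * m) :
    ∀ x ∈ {v | {v} ∈ P.faces}, ∀ y ∈ {v | {v} ∈ P.faces}, x ≠ y → 2 / (B + 1) ≤ dist x y := by
  intro x hx y hy hxy
  obtain ⟨s, hs, v, hv, hxv⟩ := hP.exists_mem_link ⟨x, hx⟩
  obtain ⟨t, ht, w, hw, hyw⟩ := hP.exists_mem_link ⟨y, hy⟩
  obtain ⟨hvc, hav, -⟩ := dist_of_mem_link hs hv
  obtain ⟨hwc, haw, -⟩ := dist_of_mem_link ht hw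
  dsimp only at hxv hyw
  rw [hxv, hyw]
  refine le_dist_centralProjection hm hmr ha hB hvc hwc hav haw ?_
  rintro rfl
  exact hxy (hxv.trans hyw.symm)

end IsCanonicalTriangulation

end SpherePacking

/-! ### Coronas with prescribed labels -/

/-- Some element of `S` with labeled scheme `τ` has its center labeled in `M`, has a vertex labeled
outside `M`, and has the edge lengths of a canonical triangulation in a packing whose sphere of
label `i` has radius `r i`. -/
def HasCorona {N n : ℕ} (S : Set (Σ d : ℕ, LabeledSphericalTriangulation d)) (r : Fin n → ℝ)
    (M : Finset (Fin n)) (τ : LabeledScheme N n) : Prop :=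
  ∃ P ∈ S, P.2.HasScheme τ ∧ ∃ i ∈ M, P.2.centerLabel = i ∧
    (∃ u, ∃ j ∉ M, P.2.label u = (j : Fin n)) ∧
    ∀ u v, P.2.IsEdge u v → ∃ j k : Fin n, P.2.label u = j ∧ P.2.label v = k ∧
      P.2.geodesicDist u v = contactAngle (r i) (r j) (r k)

/-- If the radii with labels in `L` are at most `B` times the least radius, then the spheres with
labels in `L` have boundedly many neighbors, whatever the size of those neighbors. So the number of
labeled schemes of their coronas is bounded in terms of `B`, and for each proper `M ⊆ L` one of
these coronas has its center labeled in `M` and a vertex labeled outside `M`. -/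
lemma exists_hasCorona {d n : ℕ} (S : Set (Σ d : ℕ, LabeledSphericalTriangulation d))
    (L : Finset (Fin n)) (i₀ : Fin n) (B : ℝ) :
    ∃ N : ℕ, ∀ (p : SpherePacking d) (r : Fin n → ℝ), p.IsCompactPacking → p.IsAssociatedTo S →
      StrictMono r → range r = p.radii → (∀ i, r i₀ ≤ r i) → (∀ i ∈ L, r i ≤ B * r i₀) →
      ∀ M ⊆ L, M.Nonempty → M ≠ Finset.univ → ∃ τ : LabeledScheme N n, HasCorona S r M τ := by
  obtain ⟨N, hN⟩ := exists_card_bound_of_separated d (δ := 2 / (|B| + 1)) (by positivity)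
  refine ⟨N, fun p r hp hpS hr hrange hmin hL M hML hM hM' => ?_⟩
  have hcenter : ∀ i, ∃ a ∈ p.centers, p.radius a = r i := fun i => by
    have h : r i ∈ p.radii := hrange ▸ mem_range_self i
    exact h
  obtain ⟨i, hi⟩ := hM
  obtain ⟨j, hj⟩ : ∃ j, j ∉ M := by
    by_contra! h
    exact hM' (Finset.eq_univ_of_forall h)
  obtain ⟨a, ha, ⟨i, hiM, hai⟩, b, hb, hab⟩ := hp.exists_mem_link
    {c | ∃ i ∈ M, p.radius c = r i}
    (by obtain ⟨a, ha, hai⟩ := hcenter i; exact ⟨a, ha, i, hi, hai⟩)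
    (by
      obtain ⟨b, hb, hbj⟩ := hcenter j
      refine ⟨b, hb, ?_⟩
      rintro ⟨k, hk, hbk⟩
      exact hj (hr.injective (hbj.symm.trans hbk) ▸ hk))
  obtain ⟨P, hP, hPS⟩ := hpS a ha
  have h0 := SpherePacking.pos_of_range_eq hrange i₀
  have hle : ∀ c ∈ p.centers, r i₀ ≤ p.radius c := fun c hc => by
    obtain ⟨k, hk, -⟩ := SpherePacking.exists_radius_eq hr hrange hc
    exact hk ▸ hmin k
  obtain ⟨hfin, hcard⟩ := hN {v | {v} ∈ P.faces}
    (fun v hv => P.norm_eq_one _ hv v (by simp))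
    (hP.separated_vertices h0 hle ha
      (hai ▸ (hL i (hML hiM)).trans (mul_le_mul_of_nonneg_right (le_abs_self B) h0.le)))
  have hc : P.centerLabel = i := by
    rw [hP.centerLabel_eq, SpherePacking.canonicalLabel_eq hr hrange hai]
  obtain ⟨τ, hτ⟩ := P.exists_hasScheme hfin hcard (hc ▸ i.2) (hP.label_lt hr hrange)
  have hbc := (SpherePacking.dist_of_mem_link hab (Finset.mem_singleton_self b)).1
  obtain ⟨k, hk, hlk⟩ := SpherePacking.exists_radius_eq hr hrange hbc
  refine ⟨τ, ⟨d, P⟩, hPS, hτ, i, hiM, hc, ⟨⟨centralProjection (b - a), ?_⟩, k, ?_, ?_⟩,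
    fun u v huv => hP.geodesicDist_eq hr hrange ha hai huv⟩
  · exact (hP.mem_faces_iff _).2 ⟨{b}, hab, by simp⟩
  · exact fun h => hb ⟨k, h, hk⟩
  · dsimp only
    rw [hP.label_eq {b} hab b (by simp) _ rfl, hlk]

/-- If `r' / r` is minimal exactly on `M`, then, on passing from `r` to `r'`, no angle at a sphere
labeled in `M` decreases, and the angles involving a neighbor labeled outside `M` increase. Hence
no corona as in `HasCorona` can occur for both `r` and `r'`. -/
lemma IsHeteroperturbative.not_hasCorona {N n : ℕ}
    {S : Set (Σ d : ℕ, LabeledSphericalTriangulation d)} (hS : IsHeteroperturbative S)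
    {r r' : Fin n → ℝ} (hr : ∀ i, 0 < r i) (hr' : ∀ i, 0 < r' i) {M : Finset (Fin n)}
    (hM : ∀ i ∈ M, ∀ j, r' i / r i ≤ r' j / r j)
    (hM' : ∀ i ∈ M, ∀ j ∉ M, r' i / r i < r' j / r j) {τ : LabeledScheme N n}
    (h : HasCorona S r M τ) : ¬ HasCorona S r' M τ := by
  intro h'
  obtain ⟨P, hP, hPτ, i, hi, hPi, ⟨u, j, hj, hu⟩, hPe⟩ := h
  obtain ⟨Q, hQ, hQτ, i', -, hQi, -, hQe⟩ := h'
  obtain ⟨e, he⟩ := hPτ.exists_isLabeledEquiv hQτ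
  obtain rfl : i' = i := Fin.ext (by rw [← hPi, ← hQi, he.centerLabel_eq])
  have hle : ∀ j, r j / r i' ≤ r' j / r' i' := fun j => by
    have := hM i' hi j
    rw [div_le_div_iff₀ (hr _) (hr _)] at this
    rw [div_le_div_iff₀ (hr _) (hr' _)]
    linarith
  have hlt : ∀ j ∉ M, r j / r i' < r' j / r' i' := fun j hj => by
    have := hM' i' hi j hj
    rw [div_lt_div_iff₀ (hr _) (hr _)] at this
    rw [div_lt_div_iff₀ (hr _) (hr' _)]
    linarith
  have hedge : ∀ v w, P.2.IsEdge v w → ∃ j k : Fin n, P.2.label v = j ∧ P.2.label w = k ∧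
      P.2.geodesicDist v w = contactAngle (r i') (r j) (r k) ∧
      Q.2.geodesicDist (e v) (e w) = contactAngle (r' i') (r' j) (r' k) := by
    intro v w hvw
    obtain ⟨j, k, hj, hk, hd⟩ := hPe v w hvw
    obtain ⟨j', k', hj', hk', hd'⟩ := hQe _ _ (he.isEdge hvw)
    obtain rfl : j' = j := Fin.ext (by rw [← hj, ← hj', he.label_eq])
    obtain rfl : k' = k := Fin.ext (by rw [← hk, ← hk', he.label_eq])
    exact ⟨j', k', hj, hk, hd, hd'⟩
  obtain ⟨v, huv⟩ := P.2.exists_isEdge u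
  have hne : ¬ P.2.EdgeIsometric Q.2 e := fun hiso => by
    obtain ⟨j', k, hj', -, h1, h2⟩ := hedge u v huv
    obtain rfl : j' = j := Fin.ext (by rw [← hj', hu])
    refine (contactAngle_lt_contactAngle (hr i') (hr j') (hr k) (hr' i') (hr' j') (hr' k)
      (hlt j' hj) (hle k)).ne ?_
    rw [← h1, ← h2, hiso u v huv]
  obtain ⟨⟨x, y, hxy, hlt'⟩, -⟩ := hS P hP Q hQ e he hne
  obtain ⟨j, k, -, -, h1, h2⟩ := hedge x y hxy
  rw [h1, h2] at hlt'
  exact hlt'.not_ge (contactAngle_le_contactAngle (hr i') (hr j) (hr k) (hr' i') (hr' j) (hr' k)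
    (hle j) (hle k))

/-! ### Finiteness -/

/-- In an infinite set of vectors of radii one can pass to an infinite subset on which each radius,
relative to the one with index `i₀`, is either bounded or tends to infinity. -/
lemma exists_infinite_bounded_or_escaping {n : ℕ} {X : Set (Fin n → ℝ)} (hX : X.Infinite)
    (hpos : ∀ r ∈ X, ∀ i, 0 < r i) (i₀ : Fin n) :
    ∃ (L : Finset (Fin n)) (B : ℝ) (Y : Set (Fin n → ℝ)), Y ⊆ X ∧ Y.Infinite ∧
      (∀ r ∈ Y, ∀ i ∈ L, r i ≤ B * r i₀) ∧
      ∀ j ∉ L, ∀ C : ℝ, {r ∈ Y | r j ≤ C * r i₀}.Finite := by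
  -- `L` is a largest set of indices that can be made bounded on an infinite subset.
  obtain ⟨L, ⟨B, Y, hYX, hY, hB⟩, hmax⟩ := (toFinite {L : Finset (Fin n) |
    ∃ (B : ℝ) (Y : Set (Fin n → ℝ)), Y ⊆ X ∧ Y.Infinite ∧
      ∀ r ∈ Y, ∀ i ∈ L, r i ≤ B * r i₀}).exists_maximal ⟨∅, 0, X, Subset.rfl, hX, by simp⟩
  refine ⟨L, B, Y, hYX, hY, hB, fun j hj C => ?_⟩
  by_contra hinf
  refine hj (hmax (y := insert j L) ⟨max B C, {r ∈ Y | r j ≤ C * r i₀},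
    (sep_subset _ _).trans hYX, hinf, fun r hr i hi => ?_⟩ (Finset.subset_insert _ _)
    (Finset.mem_insert_self _ _))
  have h0 := (hpos r (hYX hr.1) i₀).le
  rcases Finset.mem_insert.1 hi with rfl | hi
  · exact hr.2.trans (mul_le_mul_of_nonneg_right (le_max_right _ _) h0)
  · exact (hB r hr.1 i hi).trans (mul_le_mul_of_nonneg_right (le_max_left _ _) h0)

/-- The increasing enumerations of the elements of `Π_{d,n}(S)`. -/
def radiiVectors (d n : ℕ) (S : Set (Σ d : ℕ, LabeledSphericalTriangulation d)) :
    Set (Fin n → ℝ) :=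
  {r | StrictMono r ∧ range r ∈ radiiConfigurations d n S}

lemma radiiConfigurations_subset_image (d n : ℕ)
    (S : Set (Σ d : ℕ, LabeledSphericalTriangulation d)) :
    radiiConfigurations d n S ⊆ range '' radiiVectors d n S := by
  rintro R ⟨p, hp, hpS, hcard, hmax, rfl⟩
  have hfin : p.radii.Finite := finite_of_encard_eq_coe hcard
  have hn : hfin.toFinset.card = n := by
    rw [hfin.encard_eq_coe_toFinset_card] at hcard
    exact_mod_cast hcard
  have hrange : range (hfin.toFinset.orderEmbOfFin hn) = p.radii := by
    rw [Finset.range_orderEmbOfFin, hfin.coe_toFinset]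
  refine ⟨hfin.toFinset.orderEmbOfFin hn, ⟨OrderEmbedding.strictMono _, ?_⟩, hrange⟩
  rw [hrange]
  exact ⟨p, hp, hpS, hcard, hmax, rfl⟩

/-- Proportional elements of `radiiVectors` agree, as the largest radius is `1`. -/
lemma eq_of_div_eq {d n : ℕ} {S : Set (Σ d : ℕ, LabeledSphericalTriangulation d)}
    {r r' : Fin n → ℝ} (hr : r ∈ radiiVectors d n S) (hr' : r' ∈ radiiVectors d n S)
    (h : ∀ i j, r' i / r i = r' j / r j) : r = r' := by
  obtain ⟨hmono, p, -, -, -, hmax, hp⟩ := hr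
  obtain ⟨hmono', p', -, -, -, hmax', hp'⟩ := hr'
  rw [← hp] at hmax
  rw [← hp'] at hmax'
  obtain ⟨k, hk⟩ := hmax.1
  obtain ⟨k', hk'⟩ := hmax'.1
  have hkk : k = k' := le_antisymm
    (hmono'.le_iff_le.1 (hk' ▸ hmax'.2 (mem_range_self k)))
    (hmono.le_iff_le.1 (hk ▸ hmax.2 (mem_range_self k')))
  subst hkk
  funext i
  have hi := h i k
  rw [hk, hk', div_one, div_eq_one_iff_eq (SpherePacking.pos_of_range_eq hp i).ne'] at hi
  exact hi.symm

lemma radiiVectors_finite {d n : ℕ} (hn : 2 ≤ n)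
    {S : Set (Σ d : ℕ, LabeledSphericalTriangulation d)} (hS : IsHeteroperturbative S) :
    (radiiVectors d n S).Finite := by
  classical
  by_contra hinf
  have hpos : ∀ r ∈ radiiVectors d n S, ∀ i, 0 < r i := by
    rintro r ⟨-, p, -, -, -, -, hp⟩ i
    exact SpherePacking.pos_of_range_eq hp i
  let i₀ : Fin n := ⟨0, by omega⟩
  obtain ⟨L, B, Y, hYX, hY, hB, hesc⟩ := exists_infinite_bounded_or_escaping hinf hpos i₀
  obtain ⟨N, hN⟩ := exists_hasCorona (d := d) S L i₀ B
  -- Each vector of radii chooses a scheme for each `M`; infinitely many make the same choices.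
  have hchoice : ∀ r : Y, ∃ c : Finset (Fin n) → LabeledScheme N n,
      ∀ M ⊆ L, M.Nonempty → M ≠ Finset.univ → HasCorona S r.1 M (c M) := by
    rintro ⟨r, hr⟩
    obtain ⟨hmono, p, hp, hpS, -, -, hrange⟩ := hYX hr
    have : Nonempty (LabeledScheme N n) := ⟨⟨0, ∅, fun _ => i₀, i₀⟩⟩
    have h := hN p r hp hpS hmono hrange
      (fun i => hmono.monotone (Fin.le_def.2 (Nat.zero_le _))) (hB r hr)
    choose! c hc using h
    exact ⟨c, hc⟩
  choose c hc using hchoice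
  have : Infinite Y := hY.to_subtype
  obtain ⟨g, hg⟩ := Finite.exists_infinite_fiber c
  have hZ : (c ⁻¹' {g}).Infinite := infinite_coe_iff.1 hg
  obtain ⟨⟨r, hr⟩, hrg⟩ := hZ.nonempty
  -- All but finitely many `r'` exceed `r`, relative to the least radius, in all escaping indices.
  have hbad : ({r} ∪ ⋃ j ∈ (Lᶜ : Finset (Fin n)),
      {r' ∈ Y | r' j ≤ (r j / r i₀) * r' i₀}).Finite :=
    (finite_singleton r).union ((Lᶜ : Finset (Fin n)).finite_toSet.biUnion fun j hj =>
      hesc j (by simpa using hj) _)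
  obtain ⟨_, ⟨⟨r', hr'⟩, hrg', rfl⟩, hgood⟩ :=
    (hZ.image Subtype.val_injective.injOn).exists_notMem_finite hbad
  simp only [mem_union, mem_singleton_iff, Finset.mem_compl, mem_iUnion, not_or, not_exists,
    mem_ofPred_eq, not_and, not_le] at hgood
  obtain ⟨hne, hgood⟩ := hgood
  have hr0 := hpos r (hYX hr)
  have hr0' := hpos r' (hYX hr')
  obtain ⟨m, -, hm⟩ := Finset.exists_min_image Finset.univ (fun i => r' i / r i)
    ⟨i₀, Finset.mem_univ _⟩
  let M : Finset (Fin n) := {i | r' i / r i = r' m / r m}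
  have hML : M ⊆ L := fun j hj => by
    by_contra hjL
    have h1 := hgood j hjL hr'
    have h2 : r' j / r j ≤ r' i₀ / r i₀ :=
      (Finset.mem_filter.1 hj).2.le.trans (hm i₀ (Finset.mem_univ _))
    rw [div_le_div_iff₀ (hr0 _) (hr0 _)] at h2
    rw [div_mul_eq_mul_div, div_lt_iff₀ (hr0 _)] at h1
    linarith
  have hMuniv : M ≠ Finset.univ := fun h => by
    refine hne (eq_of_div_eq (hYX hr) (hYX hr') fun i j => ?_).symm
    have hi : i ∈ M := h ▸ Finset.mem_univ i
    have hj : j ∈ M := h ▸ Finset.mem_univ j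
    exact (Finset.mem_filter.1 hi).2.trans (Finset.mem_filter.1 hj).2.symm
  have hMne : M.Nonempty := ⟨m, by simp [M]⟩
  have hMle : ∀ i ∈ M, ∀ j, r' i / r i ≤ r' j / r j := fun i hi j =>
    (Finset.mem_filter.1 hi).2.le.trans (hm j (Finset.mem_univ _))
  have hMlt : ∀ i ∈ M, ∀ j ∉ M, r' i / r i < r' j / r j := fun i hi j hj =>
    lt_of_le_of_ne (hMle i hi j) fun h =>
      hj (Finset.mem_filter.2 ⟨Finset.mem_univ _, h.symm.trans (Finset.mem_filter.1 hi).2⟩)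
  have h1 := hc ⟨r, hr⟩ M hML hMne hMuniv
  have h2 := hc ⟨r', hr'⟩ M hML hMne hMuniv
  rw [show c ⟨r, hr⟩ = g from hrg] at h1
  rw [show c ⟨r', hr'⟩ = g from hrg'] at h2
  exact hS.not_hasCorona hr0 hr0' hMle hMlt h1 h2

theorem theorem1p2 (d n : ℕ) (hd : 2 ≤ d) (hn : 2 ≤ n)
    (S : Set (Σ d : ℕ, LabeledSphericalTriangulation d)) (hS : IsHeteroperturbative S) :
    (radiiConfigurations d n S).Finite :=
  ((radiiVectors_finite hn hS).image range).subset (radiiConfigurations_subset_image d n S)
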